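/- Let $m\ge 1$. Index the points of a cloud $Z=(z_0,\dots,z_{m-1})\in\mathbb C^m$ by $0,\dots,m-1$, let a permutation $\pi\in S_m$ act by $(\pi^*Z)_i=Z_{\pi^{-1}(i)}$ on vectors, by $(\pi^*T)_{ij}=T_{\pi^{-1}(i)\pi^{-1}(j)}$ on $T\in(\mathbb C^m)^{\otimes 2}$, and channelwise on $(\mathbb C^m)^{\ell}$. Let $\mathrm{Stab}(0)=\{\pi\in S_m:\pi(0)=0\}$ and let $\tau_i$ be the transposition of $i$ and $0$. Let $\mathcal R(m)$ be the set of continuous $f:\mathbb C^m\to\mathbb C$ with $f(\theta\pi^*Z)=\theta f(Z)$ for all $Z\in\mathbb C^m$, $\pi\in S_m$ and $\theta\in\mathbb C$ with $|\theta|=1$. Let $\sigma:\mathbb R\to\mathbb R$ be continuous and not a polynomial, and put $\rho(x+iy)=\sigma(x)+i\sigma(y)$, applied entrywise. A linear layer means a real-linear map plus a constant bias; it is $\mathrm{Stab}(0)$-equivariant if the linear part is equivariant and the bias is invariant under $\mathrm{Stab}(0)$. - A weight unit $\alpha:\mathbb C^m\to\mathbb C$, $\alpha\in\mathcal{NS}(m)$,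 is a map computed as follows. Early layers: apply to $Z\otimes\overline Z=(z_i\overline{z_j})_{i,j}$ a $\mathrm{Stab}(0)$-equivariant linear layer $(\mathbb C^m)^{\otimes 2}\to(\mathbb C^m)^{\ell_1}$ followed by $\rho$, and then finitely many (possibly no) further $\mathrm{Stab}(0)$-equivariant linear layers $(\mathbb C^m)^{\ell_j}\to(\mathbb C^m)^{\ell_{j+1}}$, each followed by $\rho$. Then sum each channel over the $m$ points. Late layers: apply to the resulting vector finitely many (at least one) fully connected linear layers, with $\rho$ between consecutive ones, the last with values in $\mathbb C$. Depths and numbers of channels are arbitrary. - A vector unit $\psi:\mathbb C\to\mathbb C$, $\psi\in\mathcal{NC}$, is a composition of finitely many (at least one) fully connected complex-linear layers without bias (of arbitrary widths), where between consecutive layers each channel is passed through a complex ReLU $\rho_{\mathbb C}(z,\eta)=\mathrm{ReLU}(|z|-\eta)\,z/|z|$ (with $\rho_{\mathbb C}(0,\eta)=0$) with its own parameter $\eta\ge 0$. - $\mathcal{NR}(m)$ is the set of all $\Psi(Z)=\sum_{i=0}^{m-1}\alpha(\tau_i^*Z)\,\psi(z_i)$ with $\alpha\in\mathcal{NS}(m)$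 and $\psi\in\mathcal{NC}$. Theorem. $\mathcal{NR}(m)$ is universal for $\mathcal R(m)$: $\mathcal{NR}(m)\subseteq\mathcal R(m)$, and for every $f\in\mathcal R(m)$, every compact $K\subset\mathbb C^m$ and every $\varepsilon>0$ there is $\Psi\in\mathcal{NR}(m)$ with $|\Psi(Z)-f(Z)|<\varepsilon$ for all $Z\in K$. -/

import Mathlib

namespace ZZNet

/-! ### Symmetries of point clouds

A cloud of `m` points in the plane is a vector `Z : Fin m → ℂ`; an order-two tensor is an
array `T : Fin m → Fin m → ℂ`; a multivector with `l` channels is `V : Fin l → Fin m → ℂ`. -/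

/-- Action of a permutation on vectors: `(π^* Z)_i = Z_{π⁻¹ i}`. -/
def permVec {m : ℕ} (π : Equiv.Perm (Fin m)) (Z : Fin m → ℂ) : Fin m → ℂ :=
  fun i => Z (π⁻¹ i)

/-- Action of a permutation on order-two tensors: `(π^* T)_{ij} = T_{π⁻¹ i, π⁻¹ j}`. -/
def permTensor {m : ℕ} (π : Equiv.Perm (Fin m)) (T : Fin m → Fin m → ℂ) : Fin m → Fin m → ℂ :=
  fun i j => T (π⁻¹ i) (π⁻¹ j)

/-- Action of a permutation on multivectors, channel by channel. -/
def permMulti {m l : ℕ} (π : Equiv.Perm (Fin m)) (V : Fin l → Fin m → ℂ) : Fin l → Fin m → ℂ :=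
  fun c => permVec π (V c)

/-- The space `R(m)`: continuous `f : ℂ^m → ℂ` with `f (θ π^* Z) = θ f(Z)` for all
permutations `π` and all rotations `θ` in the unit circle. -/
def R (m : ℕ) : Set ((Fin m → ℂ) → ℂ) :=
  {f | Continuous f ∧ ∀ (π : Equiv.Perm (Fin m)) (θ : Circle) (Z : Fin m → ℂ),
    f ((θ : ℂ) • permVec π Z) = (θ : ℂ) * f Z}

/-- The tensor `Z ⊗ Z̄ = (z_i * conj z_j)_{ij}`. -/
def tensorConj {m : ℕ} (Z : Fin m → ℂ) : Fin m → Fin m → ℂ :=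
  fun i j => Z i * (starRingEnd ℂ) (Z j)

/-- A real activation function applied separately to real and imaginary parts. -/
def cact (σ : ℝ → ℝ) (z : ℂ) : ℂ := ⟨σ z.re, σ z.im⟩

/-! ### Weight units -/

/-- A multivector is `Stab(0)`-invariant. These are the admissible biases. -/
def StabInvariant {m l : ℕ} [NeZero m] (b : Fin l → Fin m → ℂ) : Prop :=
  ∀ π : Equiv.Perm (Fin m), π 0 = 0 → permMulti π b = b

/-- `Stab(0)`-equivariance of a real-linear map from order-two tensors to multivectors. -/
def StabEquivariantFirst {m l : ℕ} [NeZero m]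
    (B : (Fin m → Fin m → ℂ) →ₗ[ℝ] (Fin l → Fin m → ℂ)) : Prop :=
  ∀ π : Equiv.Perm (Fin m), π 0 = 0 → ∀ T, B (permTensor π T) = permMulti π (B T)

/-- `Stab(0)`-equivariance of a real-linear map between spaces of multivectors. -/
def StabEquivariant {m k l : ℕ} [NeZero m]
    (B : (Fin k → Fin m → ℂ) →ₗ[ℝ] (Fin l → Fin m → ℂ)) : Prop :=
  ∀ π : Equiv.Perm (Fin m), π 0 = 0 → ∀ V, B (permMulti π V) = permMulti π (B V)

/-- `EarlyLayers m σ l F`: the map `F : ℂ^m → (ℂ^m)^l` is computed by the early layers of a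
weight unit: a `Stab(0)`-equivariant real-linear layer with bias applied to `Z ⊗ Z̄` and followed
by the pointwise nonlinearity, then any number of further `Stab(0)`-equivariant real-linear layers
with bias, each followed by the pointwise nonlinearity. -/
inductive EarlyLayers (m : ℕ) [NeZero m] (σ : ℝ → ℝ) :
    (l : ℕ) → ((Fin m → ℂ) → (Fin l → Fin m → ℂ)) → Prop
  | first (l : ℕ) (B : (Fin m → Fin m → ℂ) →ₗ[ℝ] (Fin l → Fin m → ℂ)) (b : Fin l → Fin m → ℂ)
      (hB : StabEquivariantFirst B) (hb : StabInvariant b) :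
      EarlyLayers m σ l (fun Z c i => cact σ (B (tensorConj Z) c i + b c i))
  | next (k l : ℕ) (F : (Fin m → ℂ) → (Fin k → Fin m → ℂ))
      (B : (Fin k → Fin m → ℂ) →ₗ[ℝ] (Fin l → Fin m → ℂ)) (b : Fin l → Fin m → ℂ)
      (hF : EarlyLayers m σ k F) (hB : StabEquivariant B) (hb : StabInvariant b) :
      EarlyLayers m σ l (fun Z c i => cact σ (B (F Z) c i + b c i))

/-- `LateLayers σ k l G`: the map `G : ℂ^k → ℂ^l` is a fully connected network: real-linear layers
with bias in alternation with the pointwise nonlinearity, ending with a linear layer. -/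
inductive LateLayers (σ : ℝ → ℝ) (k : ℕ) : (l : ℕ) → ((Fin k → ℂ) → (Fin l → ℂ)) → Prop
  | first (l : ℕ) (A : (Fin k → ℂ) →ₗ[ℝ] (Fin l → ℂ)) (b : Fin l → ℂ) :
      LateLayers σ k l (fun v => A v + b)
  | next (l l' : ℕ) (G : (Fin k → ℂ) → (Fin l → ℂ))
      (A : (Fin l → ℂ) →ₗ[ℝ] (Fin l' → ℂ)) (b : Fin l' → ℂ) (hG : LateLayers σ k l G) :
      LateLayers σ k l' (fun v => A (fun j => cact σ (G v j)) + b)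

/-- The set of weight units `α : ℂ^m → ℂ`: early layers, then summation over the points in each
channel, then late layers with a single complex output. -/
def NS (m : ℕ) [NeZero m] (σ : ℝ → ℝ) : Set ((Fin m → ℂ) → ℂ) :=
  {α | ∃ (k : ℕ) (F : (Fin m → ℂ) → (Fin k → Fin m → ℂ)) (G : (Fin k → ℂ) → (Fin 1 → ℂ)),
    EarlyLayers m σ k F ∧ LateLayers σ k 1 G ∧
    α = fun Z => G (fun c => ∑ i, F Z c i) 0}

/-! ### Vector units -/

/-- The complex ReLU `ReLU(|z| - η) z / |z|`; its value at `z = 0` is `0`. -/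
noncomputable def crelu (η : ℝ) (z : ℂ) : ℂ := ((max (‖z‖ - η) 0 : ℝ) : ℂ) * (z / (‖z‖ : ℂ))

/-- `VectorLayers l N`: the map `N : ℂ → ℂ^l` is a network of complex-linear layers without bias,
in alternation with complex ReLUs (each channel with its own parameter `η ≥ 0`), ending with a
linear layer. -/
inductive VectorLayers : (l : ℕ) → (ℂ → (Fin l → ℂ)) → Prop
  | first (l : ℕ) (A : ℂ →ₗ[ℂ] (Fin l → ℂ)) : VectorLayers l (fun z => A z)
  | next (k l : ℕ) (N : ℂ → (Fin k → ℂ)) (η : Fin k → ℝ) (A : (Fin k → ℂ) →ₗ[ℂ] (Fin l → ℂ))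
      (hN : VectorLayers k N) (hη : ∀ j, 0 ≤ η j) :
      VectorLayers l (fun z => A (fun j => crelu (η j) (N z j)))

/-- The set of vector units `ψ : ℂ → ℂ`. -/
def NC : Set (ℂ → ℂ) :=
  {ψ | ∃ N : ℂ → (Fin 1 → ℂ), VectorLayers 1 N ∧ ψ = fun z => N z 0}

/-! ### The full networks -/

/-- The set of networks `Ψ(Z) = ∑ i, α(τ_i^* Z) ψ(z_i)` with `α` a weight unit, `ψ` a vector unit
and `τ_i` the transposition of `i` and `0`. -/
def NR (m : ℕ) [NeZero m] (σ : ℝ → ℝ) : Set ((Fin m → ℂ) → ℂ) :=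
  {Ψ | ∃ α ∈ NS m σ, ∃ ψ ∈ NC,
    Ψ = fun Z => ∑ i, α (permVec (Equiv.swap i 0) Z) * ψ (Z i)}

/-- `N` is universal for `S`: it consists of elements of `S`, and every element of `S` can be
approximated by elements of `N`, uniformly on every compact set. -/
def UniversalFor {m : ℕ} (N S : Set ((Fin m → ℂ) → ℂ)) : Prop :=
  N ⊆ S ∧ ∀ f ∈ S, ∀ K : Set (Fin m → ℂ), IsCompact K → ∀ ε : ℝ, 0 < ε →
    ∃ Ψ ∈ N, ∀ Z ∈ K, ‖Ψ Z - f Z‖ < ε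

end ZZNet

namespace ZZNet

open Filter Topology MeasureTheory
open scoped ContDiff

/-! ### Smooth functions with a vanishing iterated derivative -/

/-! The vector unit can be the identity, because the weight can carry all of `f`: the weight `conj
z_0 * f Z / (|Z|² + δ)` is invariant under rotations and `Stab(0)`, and summing it against the `z_i`
gives `f Z * |Z|² / (|Z|² + δ)` (`sum_exactWeight`). Since `f 0 = 0`, this is uniformly close to `f`
on compact sets for small `δ`.

It remains to approximate an invariant weight (`exists_NS_approx`). Column `0` of `Z ⊗ Z̄`, with its
`0`-th entry marked, determines `Z` up to rotation and `Stab(0)` once `z_0 ≠ 0`; the clouds with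
`z_0 = 0` do no harm, as the weight vanishes there. Sums over the points of ridge functions of this
column determine it up to order (`exists_perm_of_sum_ridge_eq`), so the weight is constant on their
common fibres and is approximated by ridge functions along these sums.

Both uses of `σ` rest on one density theorem (`mem_of_ridge_mem_of_fibres`). A closed subspace
containing all ridge functions of a non-polynomial `σ` along `ℓ` contains the powers of `ℓ`, hence
`exp ℓ`; the exponentials along a linear space of directions span an algebra, to which
Stone-Weierstrass applies. -/

theorem exists_polynomial_derivative_eq {n : ℕ} (p : Polynomial ℝ) (hp : p.degree < n) :
    ∃ q : Polynomial ℝ, q.derivative = p ∧ q.degree < (n + 1 : ℕ) := by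
  refine ⟨∑ i ∈ Finset.range n, Polynomial.monomial (i + 1) (p.coeff i / (i + 1)), ?_, ?_⟩
  · ext j
    rw [Polynomial.coeff_derivative, Polynomial.finsetSum_coeff]
    simp only [Polynomial.coeff_monomial, add_left_inj]
    rw [Finset.sum_ite_eq' (Finset.range n) j]
    split_ifs with hj
    · field_simp
    · rw [Polynomial.coeff_eq_zero_of_degree_lt (hp.trans_le (by simpa using hj)), zero_mul]
  · refine (Polynomial.degree_sum_le _ _).trans_lt ?_
    rw [Finset.sup_lt_iff (by simp [bot_lt_iff_ne_bot])]
    intro i hi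
    refine (Polynomial.degree_monomial_le _ _).trans_lt ?_
    have := Finset.mem_range.1 hi
    exact_mod_cast Nat.succ_lt_succ this

theorem exists_polynomial_of_iteratedDeriv_eq_zero (k : ℕ) (g : ℝ → ℝ) (hg : ContDiff ℝ ∞ g)
    (h : ∀ x, iteratedDeriv k g x = 0) :
    ∃ p : Polynomial ℝ, p.degree < k ∧ ∀ x, g x = p.eval x := by
  induction k generalizing g with
  | zero => exact ⟨0, by simp, fun x => by simpa using h x⟩
  | succ k ih =>
    obtain ⟨p, hpk, hp⟩ := ih (deriv g) (ContDiff.iterate_deriv 1 hg) (fun x => by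
      rw [← h x, iteratedDeriv_succ'])
    obtain ⟨q, hqp, hqk⟩ := exists_polynomial_derivative_eq p hpk
    have hd : Differentiable ℝ fun x => g x - q.eval x :=
      (hg.differentiable (by simp)).sub q.differentiable
    have hc : ∀ x, g x - q.eval x = g 0 - q.eval 0 := fun x =>
      is_const_of_deriv_eq_zero hd (fun y => by
        rw [deriv_fun_sub (hg.differentiable (by simp) y) q.differentiable.differentiableAt,
          Polynomial.deriv, hqp, hp, sub_self]) x 0
    refine ⟨q + Polynomial.C (g 0 - q.eval 0), ?_, fun x => ?_⟩
    · refine (Polynomial.degree_add_le _ _).trans_lt (max_lt hqk ?_)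
      exact Polynomial.degree_C_le.trans_lt (by exact_mod_cast Nat.succ_pos k)
    · have := hc x
      simp only [Polynomial.eval_add, Polynomial.eval_C]
      linarith

/-- Pointwise limits of polynomials of bounded degree are polynomials. -/
theorem exists_polynomial_of_tendsto {k : ℕ} {σ : ℝ → ℝ} {g : ℕ → ℝ → ℝ}
    (hg : ∀ n, ∃ p : Polynomial ℝ, p.degree < k ∧ ∀ x, g n x = p.eval x)
    (hlim : ∀ x, Tendsto (fun n => g n x) atTop (𝓝 (σ x))) :
    ∃ p : Polynomial ℝ, ∀ x, σ x = p.eval x := by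
  have hinj : Set.InjOn (fun i : ℕ => (i : ℝ)) (Finset.range k : Set ℕ) :=
    Nat.cast_injective.injOn
  have key : ∀ r : ℕ → ℝ, ∀ x : ℝ,
      (Lagrange.interpolate (Finset.range k) (fun i : ℕ => (i : ℝ)) r).eval x =
        ∑ i ∈ Finset.range k,
          r i * (Lagrange.basis (Finset.range k) (fun i : ℕ => (i : ℝ)) i).eval x := by
    intro r x
    simp [Lagrange.interpolate_apply, Polynomial.eval_finsetSum]
  -- A polynomial of degree below `k` depends linearly on its values at `0, ..., k - 1`, so
  -- convergence at these nodes forces convergence to the interpolant of `σ`.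
  refine ⟨Lagrange.interpolate (Finset.range k) (fun i : ℕ => (i : ℝ)) fun i => σ i, fun x => ?_⟩
  refine tendsto_nhds_unique (hlim x) ?_
  have : ∀ n, g n x = (Lagrange.interpolate (Finset.range k) (fun i : ℕ => (i : ℝ))
      fun i => g n i).eval x := by
    intro n
    obtain ⟨p, hpk, hp⟩ := hg n
    rw [hp, ← Lagrange.eq_interpolate_of_eval_eq (f := p) (fun i : ℕ => g n i) hinj (by simpa)
      fun i _ => (hp i).symm]
  simp_rw [this, key]
  exact tendsto_finsetSum _ fun i _ => (hlim i).mul_const _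

/-! ### Closed subspaces containing all ridge functions of an activation function -/

section ridge

variable {X : Type*} [TopologicalSpace X] [CompactSpace X]

/-- A closed subspace is complete, so the integral can be formed inside it and commutes with the
inclusion. -/
theorem integral_mem_of_isClosed {E : Type*} [NormedAddCommGroup E] [NormedSpace ℝ E]
    [CompleteSpace E] {V : Submodule ℝ E} (hV : IsClosed (V : Set E)) {γ : ℝ → E}
    (hγ : Continuous γ)
    (hs : HasCompactSupport γ) (h : ∀ t, γ t ∈ V) : ∫ t, γ t ∈ V := by
  have : CompleteSpace V := hV.completeSpace_coe
  let γ' : ℝ → V := fun t => ⟨γ t, h t⟩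
  have hγ' : Continuous γ' := hγ.subtype_mk h
  have hs' : HasCompactSupport γ' := by
    refine hs.mono ?_
    intro t ht h0
    exact ht (Subtype.ext h0)
  have := V.subtypeL.integral_comp_comm (hγ'.integrable_of_hasCompactSupport (μ := volume) hs')
  rw [show ∫ t, γ t = ∫ t, V.subtypeL (γ' t) from rfl, this]
  exact (∫ t, γ' t).2

/-- The ridge function `x ↦ σ (c * ℓ x + θ)`. -/
def ridge (σ : C(ℝ, ℝ)) (ℓ : C(X, ℝ)) (c θ : ℝ) : C(X, ℝ) :=
  ⟨fun x => σ (c * ℓ x + θ), by fun_prop⟩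

/-- A ridge function of a convolution is a `C(X, ℝ)`-valued integral of shifted ridge functions of
`σ`. This allows `σ` to be replaced by its mollifications. -/
theorem ridge_convolution_mem {V : Submodule ℝ C(X, ℝ)} (hV : IsClosed (V : Set C(X, ℝ)))
    {σ g φ : C(ℝ, ℝ)} {ℓ : C(X, ℝ)} (h : ∀ c θ, ridge σ ℓ c θ ∈ V) (hφ : HasCompactSupport φ)
    (hg : ∀ x, g x = ∫ t, φ t * σ (x - t)) (c θ : ℝ) : ridge g ℓ c θ ∈ V := by
  let γ : ℝ → C(X, ℝ) := fun t => φ t • ridge σ ℓ c (θ - t)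
  have hγ : Continuous γ := by
    refine ContinuousMap.continuous_of_continuous_uncurry _ ?_
    change Continuous fun p : ℝ × X => φ p.1 * σ (c * ℓ p.2 + (θ - p.1))
    fun_prop
  have hs : HasCompactSupport γ := hφ.smul_right
  have hmem := integral_mem_of_isClosed hV hγ hs fun t => V.smul_mem _ (h c _)
  convert hmem using 1
  ext x
  rw [ContinuousMap.integral_apply (hγ.integrable_of_hasCompactSupport hs)]
  change g (c * ℓ x + θ) = ∫ t, φ t * σ (c * ℓ x + (θ - t))
  simp_rw [hg, ← add_sub_assoc]

/-- A continuous curve in a closed subspace has its derivative in that subspace. -/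
theorem derivative_mem_of_isClosed {E : Type*} [NormedAddCommGroup E] [NormedSpace ℝ E]
    {V : Submodule ℝ E} (hV : IsClosed (V : Set E)) {Γ : ℝ → E} {v : E} {s : ℝ}
    (hd : HasDerivAt Γ v s) (h : ∀ t, Γ t ∈ V) : v ∈ V := by
  have := hasDerivAt_iff_tendsto_slope.1 hd
  exact hV.mem_of_tendsto this (Eventually.of_forall fun t => by
    rw [slope_def_module]
    exact V.smul_mem _ (V.sub_mem (h _) (h _)))

/-- Each differentiation in the slope `c` brings down one factor `ℓ`, and derivatives of curves in a
closed subspace stay there. -/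
theorem pow_mul_iteratedDeriv_mem {V : Submodule ℝ C(X, ℝ)} (hV : IsClosed (V : Set C(X, ℝ)))
    {g : ℝ → ℝ} (hg : ContDiff ℝ ∞ g) {ℓ : C(X, ℝ)} {θ : ℝ}
    (h : ∀ c, ∀ F : C(X, ℝ), (∀ x, F x = g (c * ℓ x + θ)) → F ∈ V) (k : ℕ) :
    ∀ c, ∀ F : C(X, ℝ), (∀ x, F x = ℓ x ^ k * iteratedDeriv k g (c * ℓ x + θ)) → F ∈ V := by
  induction k with
  | zero => simpa using h
  | succ k ih =>
    intro c F hF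
    have hcont : ∀ j, Continuous (iteratedDeriv j g) := fun j =>
      hg.continuous_iteratedDeriv j (by exact_mod_cast le_top)
    have hder : ∀ y, HasDerivAt (iteratedDeriv k g) (iteratedDeriv (k + 1) g y) y := fun y => by
      rw [iteratedDeriv_succ]
      exact (hg.differentiable_iteratedDeriv k (by exact_mod_cast WithTop.coe_lt_top _)
        y).hasDerivAt
    let Γ : ℕ → ℝ → C(X, ℝ) := fun j s =>
      ⟨fun x => ℓ x ^ j * iteratedDeriv j g (s * ℓ x + θ), by
        have := hcont j; fun_prop⟩
    have hΓ : ∀ j, Continuous (Γ j) := fun j => by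
      refine ContinuousMap.continuous_of_continuous_uncurry _ ?_
      change Continuous fun p : ℝ × X => ℓ p.2 ^ j * iteratedDeriv j g (p.1 * ℓ p.2 + θ)
      have := hcont j
      fun_prop
    -- Differentiability in the sup norm comes from writing `Γ k` as an integral of the continuous
    -- curve `Γ (k + 1)`; that identity can be checked pointwise.
    have hint : ∀ s, ∫ t in (0 : ℝ)..s, Γ (k + 1) t = Γ k s - Γ k 0 := by
      intro s
      ext x
      have := (ContinuousMap.evalCLM ℝ x).intervalIntegral_comp_comm
        ((hΓ (k + 1)).intervalIntegrable (μ := volume) 0 s)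
      change (ContinuousMap.evalCLM ℝ x) (∫ t in (0 : ℝ)..s, Γ (k + 1) t) = Γ k s x - Γ k 0 x
      rw [← this]
      refine intervalIntegral.integral_eq_sub_of_hasDerivAt (f := fun t => Γ k t x)
        (fun t _ => ?_) ?_
      · have h1 : HasDerivAt (fun t : ℝ => t * ℓ x + θ) (ℓ x) t := by
          simpa using ((hasDerivAt_id t).mul_const (ℓ x)).add_const θ
        have h2 := ((hder (t * ℓ x + θ)).comp t h1).const_mul (ℓ x ^ k)
        refine h2.congr_deriv ?_
        change _ = ℓ x ^ (k + 1) * _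
        ring
      · exact (((ContinuousMap.evalCLM ℝ x).continuous.comp (hΓ (k + 1)))).intervalIntegrable _ _
    have hd : HasDerivAt (Γ k) (Γ (k + 1) c) c := by
      have h1 := intervalIntegral.integral_hasDerivAt_right
        ((hΓ (k + 1)).intervalIntegrable (μ := volume) 0 c)
        ((hΓ (k + 1)).stronglyMeasurableAtFilter _ _) (hΓ (k + 1)).continuousAt
      have h2 : Γ k = fun s => (∫ t in (0 : ℝ)..s, Γ (k + 1) t) + Γ k 0 := by
        funext s; rw [hint]; abel
      rw [h2]
      exact h1.add_const _
    have := derivative_mem_of_isClosed hV hd fun t => ih t _ fun x => rfl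
    convert this using 1
    ext x
    exact hF x

/-- If a closed subspace contains all ridge functions of a continuous non-polynomial `σ` in the
direction `ℓ`, then it contains all powers of `ℓ`. -/
theorem pow_mem_of_ridge_mem {V : Submodule ℝ C(X, ℝ)} (hV : IsClosed (V : Set C(X, ℝ)))
    {σ : C(ℝ, ℝ)} (hpoly : ¬ ∃ p : Polynomial ℝ, ∀ x : ℝ, σ x = p.eval x) {ℓ : C(X, ℝ)}
    (h : ∀ c θ, ridge σ ℓ c θ ∈ V) (k : ℕ) : ℓ ^ k ∈ V := by
  by_contra hk
  let φ : ℕ → ContDiffBump (0 : ℝ) := fun n =>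
    ⟨1 / (n + 1 : ℝ) / 2, 1 / (n + 1 : ℝ), by positivity, half_lt_self (by positivity)⟩
  let g : ℕ → ℝ → ℝ := fun n =>
    convolution ((φ n).normed volume) σ (ContinuousLinearMap.lsmul ℝ ℝ) volume
  have hcs : ∀ n, HasCompactSupport ((φ n).normed volume) := fun n =>
    (φ n).hasCompactSupport_normed
  have hsm : ∀ n, ContDiff ℝ ∞ (g n) := fun n =>
    (hcs n).contDiff_convolution_left (n := ⊤) _ (φ n).contDiff_normed
      σ.continuous.locallyIntegrable
  -- If `ℓ ^ k` is missing, every mollification has vanishing `k`-th derivative: at slope `c = 0`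
  -- the previous lemma yields `ℓ ^ k` times that derivative at `θ`. The degree bound `k` is the
  -- same for all `n`, so it survives the limit.
  refine hpoly (exists_polynomial_of_tendsto (k := k) (g := g) (fun n => ?_) fun x => ?_)
  · refine exists_polynomial_of_iteratedDeriv_eq_zero k _ (hsm n) fun θ => ?_
    by_contra hne
    refine hk ?_
    have hmem := pow_mul_iteratedDeriv_mem hV (hsm n) (ℓ := ℓ) (θ := θ) (fun c F hF => ?_) k 0
      (iteratedDeriv k (g n) θ • ℓ ^ k) (fun x => by simp [mul_comm])
    · simpa [hne] using V.smul_mem (iteratedDeriv k (g n) θ)⁻¹ hmem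
    · have := ridge_convolution_mem hV h (φ := ⟨(φ n).normed volume, (φ n).continuous_normed⟩)
        (g := ⟨g n, (hsm n).continuous⟩) (hcs n) (fun x => rfl) c θ
      convert this using 1
      ext x
      exact hF x
  · exact ContDiffBump.convolution_tendsto_right_of_continuous
      tendsto_one_div_add_atTop_nhds_zero_nat σ.continuous x

end ridge

/-! ### Density of ridge functions -/

/-- Stone-Weierstrass theorem without separation of points: the closure of a subalgebra contains
every continuous function that is constant on the common fibres of the subalgebra. -/
theorem mem_closure_subalgebra_of_fibres {X : Type*} [TopologicalSpace X] [CompactSpace X]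
    (A : Subalgebra ℝ C(X, ℝ)) (f : C(X, ℝ))
    (hf : ∀ x y, (∀ a ∈ A, a x = a y) → f x = f y) : f ∈ A.topologicalClosure := by
  -- On the quotient by the common fibres the algebra separates points, and `f` descends to it.
  let s : Setoid X := ⟨fun x y => ∀ a ∈ A, a x = a y, fun _ _ _ => rfl,
    fun h a ha => (h a ha).symm, fun h h' a ha => (h a ha).trans (h' a ha)⟩
  let q : C(X, Quotient s) := ⟨Quotient.mk s, continuous_quotient_mk'⟩
  let Φ : C(Quotient s, ℝ) →ₐ[ℝ] C(X, ℝ) := ContinuousMap.compRightAlgHom ℝ ℝ q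
  have hΦ : Continuous Φ := q.continuous_precomp
  have hsep : (A.comap Φ).SeparatesPoints := by
    intro x y hxy
    induction x, y using Quotient.inductionOn₂ with
    | h x y =>
      have hne : ¬ ∀ a ∈ A, a x = a y := fun h => hxy (Quotient.sound h)
      push Not at hne
      obtain ⟨a, ha, hne⟩ := hne
      refine ⟨_, ⟨⟨Quotient.lift a fun u v (h : ∀ a ∈ A, a u = a v) => h a ha,
        a.continuous.quotient_lift _⟩, ?_, rfl⟩, hne⟩
      change Φ _ ∈ A
      convert ha
      ext x
      rfl
  let f' : C(Quotient s, ℝ) := ⟨Quotient.lift f hf, f.continuous.quotient_lift _⟩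
  have hf' : f' ∈ closure ((A.comap Φ : Subalgebra ℝ _) : Set C(Quotient s, ℝ)) := by
    have := ContinuousMap.continuousMap_mem_subalgebra_closure_of_separatesPoints _ hsep f'
    exact this
  have := map_mem_closure hΦ hf' (t := (A : Set C(X, ℝ))) fun a ha => ha
  exact this

section

variable {X : Type*} [TopologicalSpace X]

/-- The exponential of a continuous function. -/
noncomputable def expMap (ℓ : C(X, ℝ)) : C(X, ℝ) := ⟨fun x => Real.exp (ℓ x), by fun_prop⟩

theorem expMap_mem_of_pow_mem [CompactSpace X] {V : Submodule ℝ C(X, ℝ)}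
    (hV : IsClosed (V : Set C(X, ℝ))) {ℓ : C(X, ℝ)} (h : ∀ k : ℕ, ℓ ^ k ∈ V) :
    expMap ℓ ∈ V := by
  have h1 := NormedSpace.exp_series_hasSum_exp' (𝕂 := ℝ) ℓ
  have h2 : NormedSpace.exp ℓ = expMap ℓ := by
    ext x
    have h3 := h1.map (ContinuousMap.evalCLM ℝ x) (ContinuousMap.evalCLM ℝ x).continuous
    have h4 := NormedSpace.exp_series_hasSum_exp' (𝕂 := ℝ) (ℓ x)
    rw [← Real.exp_eq_exp_ℝ] at h4
    exact h3.unique h4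
  rw [← h2]
  exact hV.mem_of_tendsto h1 (Eventually.of_forall fun s =>
    V.sum_mem fun k _ => V.smul_mem _ (h k))

/-- Ridge functions of a non-polynomial continuous activation along a linear space `L` of
directions are dense among the continuous functions that are constant on the fibres of `L`. -/
theorem mem_of_ridge_mem_of_fibres [CompactSpace X] {V : Submodule ℝ C(X, ℝ)}
    (hV : IsClosed (V : Set C(X, ℝ))) {σ : C(ℝ, ℝ)}
    (hpoly : ¬ ∃ p : Polynomial ℝ, ∀ x : ℝ, σ x = p.eval x) (L : Submodule ℝ C(X, ℝ))
    (h : ∀ ℓ ∈ L, ∀ θ, ridge σ ℓ 1 θ ∈ V) (f : C(X, ℝ))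
    (hf : ∀ x y, (∀ ℓ ∈ L, ℓ x = ℓ y) → f x = f y) : f ∈ V := by
  have hexp : ∀ ℓ ∈ L, expMap ℓ ∈ V := fun ℓ hℓ =>
    expMap_mem_of_pow_mem hV (pow_mem_of_ridge_mem hV hpoly fun c θ => by
      convert h (c • ℓ) (L.smul_mem c hℓ) θ using 1
      ext x
      simp [ridge])
  let S : Submonoid C(X, ℝ) :=
    { carrier := expMap '' L
      one_mem' := ⟨0, L.zero_mem, by ext; simp [expMap]⟩
      mul_mem' := by
        rintro _ _ ⟨a, ha, rfl⟩ ⟨b, hb, rfl⟩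
        exact ⟨a + b, L.add_mem ha hb, by ext; simp [expMap, Real.exp_add]⟩ }
  let A : Subalgebra ℝ C(X, ℝ) := Algebra.adjoin ℝ S
  have hA : (A : Set C(X, ℝ)) ⊆ V := by
    have h1 : Subalgebra.toSubmodule A ≤ V := by
      -- As `L` is closed under addition, the exponentials are closed under products, so the algebra
      -- they generate is their linear span.
      rw [Algebra.adjoin_eq_span, Submonoid.closure_eq, Submodule.span_le]
      rintro _ ⟨ℓ, hℓ, rfl⟩
      exact hexp ℓ hℓ
    exact h1
  have hfA := mem_closure_subalgebra_of_fibres A f fun x y hxy => hf x y fun ℓ hℓ => by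
    have := hxy (expMap ℓ) (Algebra.subset_adjoin ⟨ℓ, hℓ, rfl⟩)
    exact Real.exp_injective this
  exact closure_minimal hA hV hfA

/-- Uniform approximation on a compact set by linear combinations of ridge functions. -/
theorem exists_ridge_span_approx {σ : C(ℝ, ℝ)}
    (hpoly : ¬ ∃ p : Polynomial ℝ, ∀ x : ℝ, σ x = p.eval x) (L : Submodule ℝ C(X, ℝ))
    {K : Set X} (hK : IsCompact K) (f : C(X, ℝ))
    (hf : ∀ x ∈ K, ∀ y ∈ K, (∀ ℓ ∈ L, ℓ x = ℓ y) → f x = f y) {ε : ℝ} (hε : 0 < ε) :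
    ∃ g ∈ Submodule.span ℝ {g | ∃ ℓ ∈ L, ∃ θ, g = ridge σ ℓ 1 θ}, ∀ x ∈ K, |g x - f x| < ε := by
  have : CompactSpace K := isCompact_iff_compactSpace.1 hK
  let r : C(X, ℝ) →ₗ[ℝ] C(K, ℝ) :=
    (ContinuousMap.compRightAlgHom ℝ ℝ (⟨Subtype.val, continuous_subtype_val⟩ : C(K, X))).toLinearMap
  let W := Submodule.span ℝ {g : C(X, ℝ) | ∃ ℓ ∈ L, ∃ θ, g = ridge σ ℓ 1 θ}
  have hmem : r f ∈ (W.map r).topologicalClosure := by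
    refine mem_of_ridge_mem_of_fibres (Submodule.isClosed_topologicalClosure _) hpoly (L.map r)
      ?_ _ ?_
    · rintro _ ⟨ℓ, hℓ, rfl⟩ θ
      exact Submodule.le_topologicalClosure _
        ⟨ridge σ ℓ 1 θ, Submodule.subset_span ⟨ℓ, hℓ, θ, rfl⟩, rfl⟩
    · intro x y h
      exact hf x x.2 y y.2 fun ℓ hℓ => h (r ℓ) ⟨ℓ, hℓ, rfl⟩
  have hmem' : r f ∈ closure ((W.map r : Submodule ℝ _) : Set C(K, ℝ)) := hmem
  obtain ⟨_, ⟨g, hg, rfl⟩, hd⟩ := Metric.mem_closure_iff.1 hmem' ε hε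
  refine ⟨g, hg, fun x hx => ?_⟩
  have := (ContinuousMap.dist_apply_le_dist (f := r f) (g := r g) ⟨x, hx⟩).trans_lt hd
  rw [dist_comm, Real.dist_eq] at this
  exact this

end

/-! ### Finite families of points are determined by sums of ridge functions -/

/-- The product of the distances to all other points of both families vanishes on them except at
`p`, so its sums count the multiplicity of `p`. Equal multiplicities give bijections of fibres,
which glue to a permutation. -/
theorem exists_perm_of_sum_eq {Y ι : Type*} [MetricSpace Y] [Fintype ι] {y y' : ι → Y}
    (h : ∀ g : C(Y, ℝ), ∑ i, g (y i) = ∑ i, g (y' i)) :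
    ∃ π : Equiv.Perm ι, ∀ i, y' (π i) = y i := by
  classical
  have hcard : ∀ p, Fintype.card {i // y i = p} = Fintype.card {i // y' i = p} := by
    intro p
    let S : Finset Y := (Finset.univ.image y ∪ Finset.univ.image y').erase p
    let g : C(Y, ℝ) := ⟨fun z => ∏ q ∈ S, dist z q, by fun_prop⟩
    have hp : g p ≠ 0 := Finset.prod_ne_zero_iff.2 fun q hq =>
      dist_ne_zero.2 (Finset.ne_of_mem_erase hq).symm
    have hz : ∀ z ∈ Finset.univ.image y ∪ Finset.univ.image y', g z = if z = p then g p else 0 := by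
      intro z hz
      split_ifs with h1
      · rw [h1]
      · exact Finset.prod_eq_zero (Finset.mem_erase.2 ⟨h1, hz⟩) (dist_self z)
    have := h g
    rw [Finset.sum_congr rfl fun i _ => hz (y i) (by simp),
      Finset.sum_congr rfl fun i _ => hz (y' i) (by simp)] at this
    simp only [← Finset.sum_filter, Finset.sum_const, nsmul_eq_mul] at this
    have := mul_right_cancel₀ hp this
    rw [Fintype.card_subtype, Fintype.card_subtype]
    exact_mod_cast this
  let e := fun p => Classical.choice (Fintype.card_eq.1 (hcard p))
  let π : ι ≃ ι := (Equiv.sigmaFiberEquiv y).symm.trans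
    ((Equiv.sigmaCongrRight e).trans (Equiv.sigmaFiberEquiv y'))
  exact ⟨π, fun i => (e (y i) ⟨i, rfl⟩).2⟩

/-- Sums of ridge functions of a non-polynomial activation, along directions that separate points,
determine finite families of points up to order. -/
theorem exists_perm_of_sum_ridge_eq {Y ι : Type*} [MetricSpace Y] [Fintype ι] {σ : C(ℝ, ℝ)}
    (hpoly : ¬ ∃ p : Polynomial ℝ, ∀ x : ℝ, σ x = p.eval x) (L : Submodule ℝ C(Y, ℝ))
    (hL : ∀ x y, (∀ ℓ ∈ L, ℓ x = ℓ y) → x = y) {y y' : ι → Y}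
    (h : ∀ ℓ ∈ L, ∀ θ, ∑ i, σ (ℓ (y i) + θ) = ∑ i, σ (ℓ (y' i) + θ)) :
    ∃ π : Equiv.Perm ι, ∀ i, y' (π i) = y i := by
  refine exists_perm_of_sum_eq fun f => ?_
  have hspan : ∀ g ∈ Submodule.span ℝ {g : C(Y, ℝ) | ∃ ℓ ∈ L, ∃ θ, g = ridge σ ℓ 1 θ},
      ∑ i, g (y i) = ∑ i, g (y' i) := by
    intro g hg
    induction hg using Submodule.span_induction with
    | mem g hg =>
      obtain ⟨ℓ, hℓ, θ, rfl⟩ := hg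
      simpa [ridge] using h ℓ hℓ θ
    | zero => simp
    | add a b _ _ ha hb => simp [Finset.sum_add_distrib, ha, hb]
    | smul c a _ ha => simp [← Finset.mul_sum, ha]
  have hK : IsCompact (Set.range y ∪ Set.range y') :=
    ((Set.finite_range y).union (Set.finite_range y')).isCompact
  have happ : ∀ ε > 0, |∑ i, f (y i) - ∑ i, f (y' i)| ≤ Fintype.card ι * (ε + ε) := by
    intro ε hε
    obtain ⟨g, hg, hgf⟩ := exists_ridge_span_approx hpoly L hK f
      (fun a _ b _ hab => by rw [hL a b hab]) hε
    have h1 : ∑ i, f (y i) - ∑ i, f (y' i) =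
        ∑ i, ((g (y' i) - f (y' i)) - (g (y i) - f (y i))) := by
      simp only [Finset.sum_sub_distrib, hspan g hg]
      ring
    rw [h1]
    refine (Finset.abs_sum_le_sum_abs _ _).trans ?_
    refine (Finset.sum_le_card_nsmul _ _ (ε + ε) fun i _ => ?_).trans_eq (by simp [mul_add])
    exact (abs_sub _ _).trans (add_le_add (hgf _ (Or.inr ⟨i, rfl⟩)).le (hgf _ (Or.inl ⟨i, rfl⟩)).le)
  have hlim : Tendsto (fun ε : ℝ => Fintype.card ι * (ε + ε)) (𝓝[>] 0) (𝓝 0) := by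
    have : Tendsto (fun ε : ℝ => Fintype.card ι * (ε + ε)) (𝓝 0) (𝓝 (Fintype.card ι * (0 + 0))) :=
      Continuous.tendsto (by fun_prop) 0
    simp only [add_zero, mul_zero] at this
    exact this.mono_left nhdsWithin_le_nhds
  have hle := ge_of_tendsto hlim (eventually_mem_nhdsWithin.mono happ)
  exact sub_eq_zero.1 (abs_nonpos_iff.1 hle)

/-! ### Symmetries and continuity of the units -/

theorem permVec_mul {m : ℕ} (π ρ : Equiv.Perm (Fin m)) (Z : Fin m → ℂ) :
    permVec (π * ρ) Z = permVec π (permVec ρ Z) := by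
  funext i
  simp [permVec, mul_inv_rev]

theorem permVec_smul {m : ℕ} (π : Equiv.Perm (Fin m)) (c : ℂ) (Z : Fin m → ℂ) :
    permVec π (c • Z) = c • permVec π Z := rfl

theorem continuous_permVec {m : ℕ} (π : Equiv.Perm (Fin m)) : Continuous (permVec π) := by
  unfold permVec
  fun_prop

theorem tensorConj_smul {m : ℕ} (θ : Circle) (Z : Fin m → ℂ) :
    tensorConj ((θ : ℂ) • Z) = tensorConj Z := by
  funext i j
  have h : (θ : ℂ) * (starRingEnd ℂ) θ = 1 := by
    rw [Complex.mul_conj, Circle.normSq_coe, Complex.ofReal_one]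
  simp only [tensorConj, Pi.smul_apply, smul_eq_mul, map_mul]
  linear_combination (Z i * (starRingEnd ℂ) (Z j)) * h

theorem continuous_cact {σ : ℝ → ℝ} (hσ : Continuous σ) : Continuous (cact σ) := by
  have : cact σ = fun z => ((σ z.re : ℝ) : ℂ) + ((σ z.im : ℝ) : ℂ) * Complex.I := by
    funext z
    exact Complex.ext (by simp [cact]) (by simp [cact])
  rw [this]
  fun_prop

section

variable {m : ℕ} [NeZero m] {σ : ℝ → ℝ}

theorem EarlyLayers.continuous (hσ : Continuous σ) {l : ℕ}
    {F : (Fin m → ℂ) → (Fin l → Fin m → ℂ)} (hF : EarlyLayers m σ l F) : Continuous F := by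
  have hc := continuous_cact hσ
  induction hF with
  | first l B b hB hb =>
    have hB' := B.continuous_of_finiteDimensional
    have ht : Continuous (tensorConj : (Fin m → ℂ) → _) := by
      unfold tensorConj
      fun_prop
    have := hB'.comp ht
    refine continuous_pi fun c => continuous_pi fun i => hc.comp (Continuous.add ?_ continuous_const)
    exact (continuous_apply i).comp ((continuous_apply c).comp this)
  | next k l F B b _ hB hb ih =>
    have hB' := B.continuous_of_finiteDimensional
    have := hB'.comp ih
    refine continuous_pi fun c => continuous_pi fun i => hc.comp (Continuous.add ?_ continuous_const)
    exact (continuous_apply i).comp ((continuous_apply c).comp this)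

theorem EarlyLayers.smul {l : ℕ} {F : (Fin m → ℂ) → (Fin l → Fin m → ℂ)}
    (hF : EarlyLayers m σ l F) (θ : Circle) (Z : Fin m → ℂ) : F ((θ : ℂ) • Z) = F Z := by
  induction hF with
  | first l B b hB hb => simp only [tensorConj_smul]
  | next k l F B b _ hB hb ih => simp only [ih]

theorem EarlyLayers.permVec {l : ℕ} {F : (Fin m → ℂ) → (Fin l → Fin m → ℂ)}
    (hF : EarlyLayers m σ l F) {π : Equiv.Perm (Fin m)} (hπ : π 0 = 0) (Z : Fin m → ℂ) :
    F (permVec π Z) = permMulti π (F Z) := by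
  induction hF with
  | first l B b hB hb =>
    funext c i
    have h1 : B (tensorConj (ZZNet.permVec π Z)) c i = B (tensorConj Z) c (π⁻¹ i) :=
      congrFun (congrFun (hB π hπ (tensorConj Z)) c) i
    have h2 : b c (π⁻¹ i) = b c i := congrFun (congrFun (hb π hπ) c) i
    change cact σ _ = cact σ (B (tensorConj Z) c (π⁻¹ i) + b c (π⁻¹ i))
    rw [h1, h2]
  | next k l F B b _ hB hb ih =>
    funext c i
    have h1 : B (F (ZZNet.permVec π Z)) c i = B (F Z) c (π⁻¹ i) := by
      rw [ih]
      exact congrFun (congrFun (hB π hπ (F Z)) c) i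
    have h2 : b c (π⁻¹ i) = b c i := congrFun (congrFun (hb π hπ) c) i
    change cact σ _ = cact σ (B (F Z) c (π⁻¹ i) + b c (π⁻¹ i))
    rw [h1, h2]

theorem LateLayers.continuous (hσ : Continuous σ) {k l : ℕ} {G : (Fin k → ℂ) → (Fin l → ℂ)}
    (hG : LateLayers σ k l G) : Continuous G := by
  have hc := continuous_cact hσ
  induction hG with
  | first l A b => exact A.continuous_of_finiteDimensional.add continuous_const
  | next l l' G A b _ ih =>
    refine (A.continuous_of_finiteDimensional.comp ?_).add continuous_const
    exact continuous_pi fun j => hc.comp ((continuous_apply j).comp ih)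

theorem continuous_of_mem_NS (hσ : Continuous σ) {α : (Fin m → ℂ) → ℂ} (hα : α ∈ NS m σ) :
    Continuous α := by
  obtain ⟨k, F, G, hF, hG, rfl⟩ := hα
  refine (continuous_apply 0).comp ((hG.continuous hσ).comp (continuous_pi fun c => ?_))
  exact continuous_finsetSum _ fun i _ =>
    (continuous_apply i).comp ((continuous_apply c).comp (hF.continuous hσ))

theorem smul_of_mem_NS {α : (Fin m → ℂ) → ℂ} (hα : α ∈ NS m σ) (θ : Circle) (Z : Fin m → ℂ) :
    α ((θ : ℂ) • Z) = α Z := by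
  obtain ⟨k, F, G, hF, hG, rfl⟩ := hα
  simp only [hF.smul]

theorem permVec_of_mem_NS {α : (Fin m → ℂ) → ℂ} (hα : α ∈ NS m σ) {π : Equiv.Perm (Fin m)}
    (hπ : π 0 = 0) (Z : Fin m → ℂ) : α (permVec π Z) = α Z := by
  obtain ⟨k, F, G, hF, hG, rfl⟩ := hα
  simp only [hF.permVec hπ]
  congr 2
  funext c
  exact Equiv.sum_comp π⁻¹ (F Z c)

end

theorem continuous_crelu {η : ℝ} (hη : 0 ≤ η) : Continuous (crelu η) := by
  rw [continuous_iff_continuousAt]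
  intro z
  by_cases hz : z = 0
  · subst hz
    have h0 : crelu η 0 = 0 := by simp [crelu]
    rw [ContinuousAt, h0]
    -- The phase `w / ‖w‖` jumps at the origin, but `η ≥ 0` bounds its factor by `‖w‖`.
    have hb : ∀ w : ℂ, ‖crelu η w‖ ≤ ‖w‖ := fun w => by
      unfold crelu
      rw [norm_mul, Complex.norm_real, Real.norm_eq_abs, norm_div, Complex.norm_real, norm_norm,
        abs_of_nonneg (le_max_right _ _)]
      exact (mul_le_of_le_one_right (le_max_right _ _) (div_self_le_one _)).trans
        (max_le (sub_le_self _ hη) (norm_nonneg _))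
    exact squeeze_zero_norm hb (by simpa using (continuous_norm (E := ℂ)).tendsto 0)
  · have : (‖z‖ : ℂ) ≠ 0 := by simpa using hz
    unfold crelu
    refine ContinuousAt.mul (by fun_prop) (ContinuousAt.div (by fun_prop) (by fun_prop) this)

theorem crelu_smul (η : ℝ) (θ : Circle) (z : ℂ) : crelu η (θ * z) = θ * crelu η z := by
  unfold crelu
  rw [norm_mul, Circle.norm_coe, one_mul]
  ring

theorem VectorLayers.continuous {l : ℕ} {N : ℂ → (Fin l → ℂ)} (hN : VectorLayers l N) :
    Continuous N := by
  induction hN with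
  | first l A => exact A.continuous_of_finiteDimensional
  | next k l N η A _ hη ih =>
    exact A.continuous_of_finiteDimensional.comp
      (continuous_pi fun j => (continuous_crelu (hη j)).comp ((continuous_apply j).comp ih))

theorem VectorLayers.smul {l : ℕ} {N : ℂ → (Fin l → ℂ)} (hN : VectorLayers l N) (θ : Circle)
    (z : ℂ) : N (θ * z) = (θ : ℂ) • N z := by
  induction hN with
  | first l A => exact A.map_smul (θ : ℂ) z
  | next k l N η A _ _ ih =>
    simp only [ih, Pi.smul_apply, smul_eq_mul, crelu_smul]
    exact A.map_smul (θ : ℂ) fun j => crelu (η j) (N z j)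

theorem NR_subset_R {m : ℕ} [NeZero m] {σ : ℝ → ℝ} (hσ : Continuous σ) : NR m σ ⊆ R m := by
  rintro _ ⟨α, hα, _, ⟨N, hN, rfl⟩, rfl⟩
  refine ⟨?_, fun π θ Z => ?_⟩
  · refine continuous_finsetSum _ fun i _ => Continuous.mul ?_ ?_
    · exact (continuous_of_mem_NS hσ hα).comp (continuous_permVec _)
    · exact (continuous_apply 0).comp (hN.continuous.comp (continuous_apply i))
  · simp only [permVec_smul, smul_of_mem_NS hα, Pi.smul_apply, smul_eq_mul, hN.smul]
    rw [← Equiv.sum_comp π, Finset.mul_sum]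
    refine Finset.sum_congr rfl fun i _ => ?_
    have h1 : permVec π Z (π i) = Z i := by simp [permVec]
    -- The product `τ_{π i} π τ_i` sends `0` to `i` to `π i` to `0`, so it lies in `Stab(0)` and `α`
    -- does not see it.
    have h2 : permVec (Equiv.swap (π i) 0) (permVec π Z) =
        permVec (Equiv.swap (π i) 0 * π * Equiv.swap i 0) (permVec (Equiv.swap i 0) Z) := by
      simp only [← permVec_mul, mul_assoc, Equiv.swap_mul_self, mul_one]
    rw [h1, h2, permVec_of_mem_NS hα (by simp)]
    ring

/-! ### Approximation by weight units -/

/-- The points `z_i * conj z_0` of a cloud, where the index `0` is marked by a second coordinate. -/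
noncomputable def markedPoint {m : ℕ} [NeZero m] (Z : Fin m → ℂ) (i : Fin m) : ℂ × ℝ :=
  (tensorConj Z i 0, if i = 0 then 1 else 0)

theorem continuous_markedPoint {m : ℕ} [NeZero m] (i : Fin m) :
    Continuous fun Z : Fin m → ℂ => markedPoint Z i := by
  unfold markedPoint tensorConj
  fun_prop

/-- The linear functionals on `ℂ × ℝ`. -/
def markedFunctionals : Submodule ℝ C(ℂ × ℝ, ℝ) where
  carrier := {ℓ | ∃ (a : ℂ) (μ : ℝ), ∀ p, ℓ p = (a * p.1).re + μ * p.2}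
  zero_mem' := ⟨0, 0, by simp⟩
  add_mem' := by
    rintro ℓ ℓ' ⟨a, μ, h⟩ ⟨a', μ', h'⟩
    exact ⟨a + a', μ + μ', fun p => by simp [h, h']; ring⟩
  smul_mem' := by
    rintro c ℓ ⟨a, μ, h⟩
    exact ⟨c * a, c * μ, fun p => by simp [h]; ring⟩

theorem markedFunctionals_separates (p q : ℂ × ℝ) (h : ∀ ℓ ∈ markedFunctionals, ℓ p = ℓ q) :
    p = q := by
  have key : ∀ (a : ℂ) (μ : ℝ), (a * p.1).re + μ * p.2 = (a * q.1).re + μ * q.2 := fun a μ =>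
    h ⟨fun p => (a * p.1).re + μ * p.2, by fun_prop⟩ ⟨a, μ, fun _ => rfl⟩
  refine Prod.ext (Complex.ext ?_ ?_) ?_
  · simpa using key 1 0
  · simpa using key (-Complex.I) 0
  · simpa using key 0 1

/-- The sum over all points of a ridge function of the marked points. -/
noncomputable def pointSum (m : ℕ) [NeZero m] (σ : C(ℝ, ℝ)) (ℓ : C(ℂ × ℝ, ℝ)) (θ : ℝ) :
    C(Fin m → ℂ, ℝ) :=
  ⟨fun Z => ∑ i, σ (ℓ (markedPoint Z i) + θ), by
    have := continuous_markedPoint (m := m)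
    fun_prop⟩

/-- The span of the point sums. -/
noncomputable def pointSums (m : ℕ) [NeZero m] (σ : C(ℝ, ℝ)) : Submodule ℝ C(Fin m → ℂ, ℝ) :=
  Submodule.span ℝ {φ | ∃ ℓ ∈ markedFunctionals, ∃ θ, φ = pointSum m σ ℓ θ}

section

variable {m : ℕ} [NeZero m] {σ : C(ℝ, ℝ)}

/-- The point sums determine a cloud with `z_0 ≠ 0` up to rotation and `Stab(0)`. -/
theorem orbit_of_pointSums_eq (hpoly : ¬ ∃ p : Polynomial ℝ, ∀ x : ℝ, σ x = p.eval x)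
    {Z Z' : Fin m → ℂ} (h : ∀ φ ∈ pointSums m σ, φ Z = φ Z') :
    (Z 0 = 0 ∧ Z' 0 = 0) ∨
      ∃ (π : Equiv.Perm (Fin m)) (θ : Circle), π 0 = 0 ∧ Z' = (θ : ℂ) • permVec π Z := by
  obtain ⟨π, hπ⟩ := exists_perm_of_sum_ridge_eq hpoly markedFunctionals markedFunctionals_separates
    (y := markedPoint Z) (y' := markedPoint Z')
    (fun ℓ hℓ θ => h _ (Submodule.subset_span ⟨ℓ, hℓ, θ, rfl⟩))
  have hπ0 : π 0 = 0 := by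
    by_contra hne
    simpa [markedPoint, hne] using congrArg Prod.snd (hπ 0)
  have hw : ∀ i, Z' (π i) * (starRingEnd ℂ) (Z' 0) = Z i * (starRingEnd ℂ) (Z 0) := fun i =>
    congrArg Prod.fst (hπ i)
  have h0 : ‖Z' 0‖ = ‖Z 0‖ := by
    have := congrArg norm (hw 0)
    rw [hπ0, norm_mul, norm_mul, RCLike.norm_conj, RCLike.norm_conj] at this
    exact (mul_self_inj (norm_nonneg _) (norm_nonneg _)).1 this
  by_cases hz : Z 0 = 0
  · left
    refine ⟨hz, ?_⟩
    rwa [hz, norm_zero, norm_eq_zero] at h0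
  · right
    have hz' : Z' 0 ≠ 0 := by
      rw [← norm_ne_zero_iff, h0, norm_ne_zero_iff]
      exact hz
    have hc' : (starRingEnd ℂ) (Z' 0) ≠ 0 := by simpa using hz'
    -- Dividing `hw` by `conj (Z' 0)` recovers `Z'` up to this factor; the entry at `0` shows that
    -- it is unimodular.
    let θ : ℂ := (starRingEnd ℂ) (Z 0) / (starRingEnd ℂ) (Z' 0)
    have hθ : ‖θ‖ = 1 := by
      rw [norm_div, RCLike.norm_conj, RCLike.norm_conj, h0, div_self (norm_ne_zero_iff.2 hz)]
    refine ⟨π, ⟨θ, mem_sphere_zero_iff_norm.2 hθ⟩, hπ0, ?_⟩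
    funext j
    change Z' j = θ * Z (π⁻¹ j)
    have := hw (π⁻¹ j)
    rw [show π (π⁻¹ j) = j from π.apply_symm_apply j] at this
    rw [div_mul_eq_mul_div, eq_div_iff hc', this, mul_comm]

/-- Linear combinations of ridge functions along point sums are weight units. -/
theorem mem_NS_of_mem_span {α : (Fin m → ℂ) → ℂ}
    (hα : α ∈ Submodule.span ℂ {g : (Fin m → ℂ) → ℂ | ∃ φ ∈ pointSums m σ, ∃ θ : ℝ,
      g = fun Z => (σ (φ Z + θ) : ℂ)}) : α ∈ NS m σ := by
  obtain ⟨n, c, g, rfl⟩ := Submodule.mem_span_set'.1 hα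
  choose φ hφ θ hg using fun j => (g j).2
  choose n' f' g' hφ' using fun j => Submodule.mem_span_set'.1 (hφ j)
  choose ℓ hℓ θ' hg' using fun j c => (g' j c).2
  choose a μ hℓ' using hℓ
  let ι := Σ j, Fin (n' j)
  let e : ι ≃ Fin (Fintype.card ι) := Fintype.equivFin ι
  -- There is one channel for each ridge function in each point sum. Reading column `0` is
  -- `Stab(0)`-equivariant, and the bias may single out index `0`, which supplies the marker.
  let B : (Fin m → Fin m → ℂ) →ₗ[ℝ] (Fin (Fintype.card ι) → Fin m → ℂ) :=
    { toFun := fun T k i => a (e.symm k).1 (e.symm k).2 * T i 0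
      map_add' := fun T T' => by
        funext k i
        simp [mul_add]
      map_smul' := fun r T => by
        funext k i
        simp
        ring }
  let b : Fin (Fintype.card ι) → Fin m → ℂ := fun k i =>
    ((μ (e.symm k).1 (e.symm k).2 * (if i = 0 then 1 else 0) + θ' (e.symm k).1 (e.symm k).2 : ℝ) : ℂ)
  -- Late layers need only be real-linear, so real parts can be taken, discarding what `σ` makes of
  -- the imaginary parts.
  let A : (Fin (Fintype.card ι) → ℂ) →ₗ[ℝ] (Fin n → ℂ) :=
    { toFun := fun v j => ((∑ d : Fin (n' j), f' j d * (v (e ⟨j, d⟩)).re : ℝ) : ℂ)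
      map_add' := fun v v' => by
        funext j
        simp [mul_add, Finset.sum_add_distrib]
      map_smul' := fun r v => by
        funext j
        simp [Finset.mul_sum, mul_left_comm] }
  let A' : (Fin n → ℂ) →ₗ[ℝ] (Fin 1 → ℂ) :=
    { toFun := fun v _ => ∑ j, c j * ((v j).re : ℂ)
      map_add' := fun v v' => by
        funext j
        simp [mul_add, Finset.sum_add_distrib]
      map_smul' := fun r v => by
        funext j
        simp [Finset.mul_sum, mul_left_comm] }
  refine ⟨_, _, _, .first _ B b (fun π hπ T => ?_) (fun π hπ => ?_),
    .next _ _ _ A' 0 (.first _ A fun j => (θ j : ℂ)), ?_⟩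
  · have h0 : π⁻¹ 0 = 0 := by rw [Equiv.Perm.inv_eq_iff_eq, hπ]
    funext k i
    simp [B, permTensor, permMulti, permVec, h0]
  · have h0 : ∀ i, π⁻¹ i = 0 ↔ i = 0 := fun i => by rw [Equiv.Perm.inv_eq_iff_eq, hπ]
    funext k i
    simp only [b, permMulti, permVec, h0]
  · funext Z
    have h1 : ∀ j d, g' j d = (pointSum m σ (ℓ j d) (θ' j d)) := hg'
    have h2 : ∀ j, (φ j) Z = ∑ d, f' j d *
        ∑ i, σ ((a j d * tensorConj Z i 0).re + μ j d * (if i = 0 then 1 else 0) + θ' j d) := by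
      intro j
      rw [← hφ' j]
      simp only [ContinuousMap.coe_sum, Finset.sum_apply, ContinuousMap.smul_apply, h1, pointSum,
        ContinuousMap.coe_mk, hℓ', smul_eq_mul, markedPoint]
    have h3 : ∀ j, (g j : (Fin m → ℂ) → ℂ) Z = (σ (φ j Z + θ j) : ℂ) := fun j => congrFun (hg j) Z
    have ha : ∀ j d, a (e.symm (e ⟨j, d⟩)).1 (e.symm (e ⟨j, d⟩)).2 = a j d := fun j d =>
      congrArg (fun q : ι => a q.1 q.2) (e.symm_apply_apply ⟨j, d⟩)
    have hμ : ∀ j d, μ (e.symm (e ⟨j, d⟩)).1 (e.symm (e ⟨j, d⟩)).2 = μ j d := fun j d =>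
      congrArg (fun q : ι => μ q.1 q.2) (e.symm_apply_apply ⟨j, d⟩)
    have hθ : ∀ j d, θ' (e.symm (e ⟨j, d⟩)).1 (e.symm (e ⟨j, d⟩)).2 = θ' j d := fun j d =>
      congrArg (fun q : ι => θ' q.1 q.2) (e.symm_apply_apply ⟨j, d⟩)
    simp [h2, h3, A', A, B, b, cact, ← add_assoc, ha, hμ, hθ]

/-- Rotation and `Stab(0)` invariant functions vanishing for `z_0 = 0` are approximated by weight
units, uniformly on compact sets. -/
theorem exists_NS_approx (hpoly : ¬ ∃ p : Polynomial ℝ, ∀ x : ℝ, σ x = p.eval x)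
    {K : Set (Fin m → ℂ)} (hK : IsCompact K) {a : (Fin m → ℂ) → ℂ} (ha : Continuous a)
    (ha0 : ∀ Z, Z 0 = 0 → a Z = 0)
    (hinv : ∀ (π : Equiv.Perm (Fin m)) (θ : Circle) Z, π 0 = 0 →
      a ((θ : ℂ) • permVec π Z) = a Z) {ε : ℝ} (hε : 0 < ε) :
    ∃ α ∈ NS m σ, ∀ Z ∈ K, ‖α Z - a Z‖ < ε := by
  have hfib : ∀ Z Z', (∀ φ ∈ pointSums m σ, φ Z = φ Z') → a Z = a Z' := by
    intro Z Z' h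
    rcases orbit_of_pointSums_eq hpoly h with ⟨h0, h0'⟩ | ⟨π, θ, hπ, rfl⟩
    · rw [ha0 _ h0, ha0 _ h0']
    · rw [hinv π θ Z hπ]
  obtain ⟨g₁, hg₁, h₁⟩ := exists_ridge_span_approx hpoly (pointSums m σ) hK
    ⟨fun Z => (a Z).re, by fun_prop⟩ (fun Z _ Z' _ h => congrArg Complex.re (hfib Z Z' h))
    (half_pos hε)
  obtain ⟨g₂, hg₂, h₂⟩ := exists_ridge_span_approx hpoly (pointSums m σ) hK
    ⟨fun Z => (a Z).im, by fun_prop⟩ (fun Z _ Z' _ h => congrArg Complex.im (hfib Z Z' h))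
    (half_pos hε)
  let W := Submodule.span ℂ {g : (Fin m → ℂ) → ℂ | ∃ φ ∈ pointSums m σ, ∃ θ : ℝ,
      g = fun Z => (σ (φ Z + θ) : ℂ)}
  have hW : ∀ g ∈ Submodule.span ℝ {g | ∃ ℓ ∈ pointSums m σ, ∃ θ, g = ridge σ ℓ 1 θ},
      (fun Z => (g Z : ℂ)) ∈ W := by
    intro g hg
    induction hg using Submodule.span_induction with
    | mem g hg =>
      obtain ⟨φ, hφ, θ, rfl⟩ := hg
      exact Submodule.subset_span ⟨φ, hφ, θ, by simp [ridge]⟩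
    | zero =>
      convert W.zero_mem using 1
      funext Z
      simp
    | add u v _ _ hu hv =>
      convert W.add_mem hu hv using 1
      funext Z
      simp
    | smul r u _ hu =>
      convert W.smul_mem (r : ℂ) hu using 1
      funext Z
      simp
  refine ⟨_, mem_NS_of_mem_span (W.add_mem (hW g₁ hg₁) (W.smul_mem Complex.I (hW g₂ hg₂))),
    fun Z hZ => ?_⟩
  refine (Complex.norm_le_abs_re_add_abs_im _).trans_lt ?_
  have e₁ := h₁ Z hZ
  have e₂ := h₂ Z hZ
  simp only [ContinuousMap.coe_mk] at e₁ e₂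
  simp
  linarith

end

/-! ### Universality -/

theorem eq_zero_of_mem_R {m : ℕ} {f : (Fin m → ℂ) → ℂ} (hf : f ∈ R m) : f 0 = 0 := by
  -- Rotation by `-1` fixes the zero cloud and negates the value.
  have h := hf.2 1 (-1) 0
  have h1 : ((-1 : Circle) : ℂ) = -1 := by simp
  rw [smul_eq_zero_of_right _ (by rfl), h1] at h
  linear_combination h / 2

/-- The sum of the squared norms of the points. -/
noncomputable def sqNorm {m : ℕ} (Z : Fin m → ℂ) : ℝ := ∑ i, ‖Z i‖ ^ 2

theorem sqNorm_nonneg {m : ℕ} (Z : Fin m → ℂ) : 0 ≤ sqNorm Z :=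
  Finset.sum_nonneg fun _ _ => by positivity

theorem continuous_sqNorm {m : ℕ} : Continuous (sqNorm : (Fin m → ℂ) → ℝ) := by
  unfold sqNorm
  fun_prop

theorem sqNorm_permVec {m : ℕ} (π : Equiv.Perm (Fin m)) (Z : Fin m → ℂ) :
    sqNorm (permVec π Z) = sqNorm Z :=
  Equiv.sum_comp π⁻¹ fun i => ‖Z i‖ ^ 2

theorem sqNorm_smul {m : ℕ} (θ : Circle) (Z : Fin m → ℂ) : sqNorm ((θ : ℂ) • Z) = sqNorm Z := by
  refine Finset.sum_congr rfl fun i _ => ?_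
  rw [Pi.smul_apply, norm_smul, Circle.norm_coe, one_mul]

/-- The exact weight `conj z_0 * f Z / (|Z|² + δ)`. -/
noncomputable def exactWeight {m : ℕ} [NeZero m] (f : (Fin m → ℂ) → ℂ) (δ : ℝ) (Z : Fin m → ℂ) :
    ℂ := (starRingEnd ℂ) (Z 0) * f Z / ((sqNorm Z + δ : ℝ) : ℂ)

section

variable {m : ℕ} [NeZero m] {f : (Fin m → ℂ) → ℂ} {δ : ℝ}

theorem continuous_exactWeight (hf : Continuous f) (hδ : 0 < δ) :
    Continuous (exactWeight f δ) := by
  have := continuous_sqNorm (m := m)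
  unfold exactWeight
  refine Continuous.div (by fun_prop) (by fun_prop) fun Z => ?_
  exact_mod_cast (add_pos_of_nonneg_of_pos (sqNorm_nonneg Z) hδ).ne'

/-- The rotation of `f` cancels against the conjugate rotation of `conj z_0`. -/
theorem exactWeight_invariant (hf : f ∈ R m) (π : Equiv.Perm (Fin m)) (θ : Circle) (Z : Fin m → ℂ)
    (hπ : π 0 = 0) : exactWeight f δ ((θ : ℂ) • permVec π Z) = exactWeight f δ Z := by
  have h : (θ : ℂ) * (starRingEnd ℂ) θ = 1 := by
    rw [Complex.mul_conj, Circle.normSq_coe, Complex.ofReal_one]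
  have h0 : π⁻¹ 0 = 0 := by rw [Equiv.Perm.inv_eq_iff_eq, hπ]
  unfold exactWeight
  rw [sqNorm_smul, sqNorm_permVec, hf.2]
  congr 1
  simp only [Pi.smul_apply, permVec, h0, smul_eq_mul, map_mul]
  linear_combination ((starRingEnd ℂ) (Z 0) * f Z) * h

theorem sum_exactWeight (hf : f ∈ R m) (Z : Fin m → ℂ) :
    ∑ i, exactWeight f δ (permVec (Equiv.swap i 0) Z) * Z i =
      f Z * ((sqNorm Z / (sqNorm Z + δ) : ℝ) : ℂ) := by
  have hfp : ∀ π, f (permVec π Z) = f Z := fun π => by simpa using hf.2 π 1 Z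
  have hi : ∀ i, exactWeight f δ (permVec (Equiv.swap i 0) Z) * Z i =
      f Z / ((sqNorm Z + δ : ℝ) : ℂ) * ((‖Z i‖ ^ 2 : ℝ) : ℂ) := fun i => by
    unfold exactWeight
    rw [sqNorm_permVec, hfp]
    have h1 : permVec (Equiv.swap i 0) Z 0 = Z i := by simp [permVec]
    have h2 := Complex.conj_mul' (Z i)
    rw [h1]
    push_cast
    rw [← h2]
    ring
  rw [Finset.sum_congr rfl fun i _ => hi i, ← Finset.mul_sum]
  unfold sqNorm
  push_cast
  ring

theorem norm_sum_exactWeight_sub (hf : f ∈ R m) (hδ : 0 < δ) (Z : Fin m → ℂ) :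
    ‖∑ i, exactWeight f δ (permVec (Equiv.swap i 0) Z) * Z i - f Z‖ =
      ‖f Z‖ * (δ / (sqNorm Z + δ)) := by
  have hpos := add_pos_of_nonneg_of_pos (sqNorm_nonneg Z) hδ
  have h : f Z * ((sqNorm Z / (sqNorm Z + δ) : ℝ) : ℂ) - f Z =
      -(f Z * ((δ / (sqNorm Z + δ) : ℝ) : ℂ)) := by
    have h1 : sqNorm Z / (sqNorm Z + δ) = 1 - δ / (sqNorm Z + δ) := by
      field_simp
      ring
    rw [h1]
    push_cast
    ring
  rw [sum_exactWeight hf, h, norm_neg, norm_mul, Complex.norm_real, Real.norm_eq_abs,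
    abs_of_nonneg (by positivity)]

theorem exists_sum_exactWeight_approx (hf : f ∈ R m) {K : Set (Fin m → ℂ)} (hK : IsCompact K)
    {ε : ℝ} (hε : 0 < ε) :
    ∃ δ > 0, ∀ Z ∈ K,
      ‖∑ i, exactWeight f δ (permVec (Equiv.swap i 0) Z) * Z i - f Z‖ < ε := by
  obtain ⟨C, hC⟩ := hK.exists_bound_of_continuousOn hf.1.continuousOn
  obtain ⟨r, hr, hfr⟩ := Metric.continuous_iff.1 hf.1 0 ε hε
  have hC1 : 0 < |C| + 1 := by positivity
  -- Within radius `r` of the origin the error is at most `‖f Z‖ < ε`. Elsewhere `sqNorm Z ≥ r ^ 2`,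
  -- and this `δ` makes `(|C| + 1) * δ = ε * r ^ 2`.
  refine ⟨ε * r ^ 2 / (|C| + 1), by positivity, fun Z hZ => ?_⟩
  have hδ : 0 < ε * r ^ 2 / (|C| + 1) := by positivity
  set δ := ε * r ^ 2 / (|C| + 1) with hδd
  have hs := sqNorm_nonneg Z
  rw [norm_sum_exactWeight_sub hf hδ]
  by_cases hZr : ‖Z‖ < r
  · have h1 := hfr Z (by simpa using hZr)
    rw [eq_zero_of_mem_R hf, dist_zero_right] at h1
    refine (mul_le_of_le_one_right (norm_nonneg _) ?_).trans_lt h1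
    exact (div_le_one (by positivity)).2 (by linarith)
  · have h2 : r ^ 2 ≤ sqNorm Z := by
      have h3 : ∃ i, r ≤ ‖Z i‖ := by
        by_contra hne
        push Not at hne
        exact hZr ((pi_norm_lt_iff hr).2 hne)
      obtain ⟨i, hi⟩ := h3
      refine (pow_le_pow_left₀ hr.le hi 2).trans ?_
      exact Finset.single_le_sum (f := fun i => ‖Z i‖ ^ 2) (fun _ _ => by positivity)
        (Finset.mem_univ i)
    have h4 : ‖f Z‖ < |C| + 1 := ((hC Z hZ).trans (le_abs_self C)).trans_lt (lt_add_one _)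
    rw [← mul_div_assoc, div_lt_iff₀ (by positivity)]
    have h5 : (|C| + 1) * δ = ε * r ^ 2 := by
      rw [hδd]
      field_simp
    have h6 : ‖f Z‖ * δ < (|C| + 1) * δ := mul_lt_mul_of_pos_right h4 hδ
    have h7 : ε * r ^ 2 ≤ ε * (sqNorm Z + δ) := mul_le_mul_of_nonneg_left (by linarith) hε.le
    linarith

end

theorem id_mem_NC : (fun z : ℂ => z) ∈ NC :=
  ⟨_, .first 1 (LinearMap.pi fun _ => LinearMap.id), rfl⟩

end ZZNet

theorem theorem2 (m : ℕ) [NeZero m] (σ : ℝ → ℝ) (hσ : Continuous σ)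
    (hpoly : ¬ ∃ p : Polynomial ℝ, ∀ x : ℝ, σ x = p.eval x) :
    ZZNet.UniversalFor (ZZNet.NR m σ) (ZZNet.R m) := by
  refine ⟨ZZNet.NR_subset_R hσ, fun f hf K hK ε hε => ?_⟩
  obtain ⟨δ, hδ, happ⟩ := ZZNet.exists_sum_exactWeight_approx hf hK (half_pos hε)
  obtain ⟨C, hC⟩ := hK.exists_bound_of_continuousOn continuous_id.continuousOn
  -- The weight is evaluated at the clouds `τ_i^* Z`, which may leave `K`.
  let K' : Set (Fin m → ℂ) := ⋃ i, ZZNet.permVec (Equiv.swap i 0) '' K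
  have hK' : IsCompact K' := isCompact_iUnion fun i => hK.image (ZZNet.continuous_permVec _)
  -- The weight error is multiplied by `‖Z i‖ ≤ |C| + 1` and summed over `m` points, for a total of
  -- `ε / 2`.
  have hη : 0 < ε / 2 / (m * (|C| + 1)) := by
    have : 0 < (m : ℝ) := Nat.cast_pos.2 (NeZero.pos m)
    positivity
  obtain ⟨α, hα, hαa⟩ := ZZNet.exists_NS_approx (σ := ⟨σ, hσ⟩) hpoly hK'
    (ZZNet.continuous_exactWeight hf.1 hδ) (fun Z hZ => by simp [ZZNet.exactWeight, hZ])
    (ZZNet.exactWeight_invariant hf) hη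
  refine ⟨_, ⟨α, hα, _, ZZNet.id_mem_NC, rfl⟩, fun Z hZ => ?_⟩
  have hsum : ‖∑ i, α (ZZNet.permVec (Equiv.swap i 0) Z) * Z i -
      ∑ i, ZZNet.exactWeight f δ (ZZNet.permVec (Equiv.swap i 0) Z) * Z i‖ ≤ ε / 2 := by
    rw [← Finset.sum_sub_distrib]
    refine (norm_sum_le _ _).trans ?_
    refine (Finset.sum_le_card_nsmul _ _ (ε / 2 / (m * (|C| + 1)) * (|C| + 1))
      fun i _ => ?_).trans_eq ?_
    · rw [← sub_mul, norm_mul]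
      refine mul_le_mul (hαa _ (Set.mem_iUnion.2 ⟨i, Z, hZ, rfl⟩)).le ?_ (norm_nonneg _) hη.le
      exact (norm_le_pi_norm Z i).trans
        ((hC Z hZ).trans ((le_abs_self C).trans (lt_add_one _).le))
    · have h1 : (m : ℝ) ≠ 0 := Nat.cast_ne_zero.2 (NeZero.ne m)
      have h2 : |C| + 1 ≠ 0 := by positivity
      simp only [Finset.card_univ, Fintype.card_fin, nsmul_eq_mul]
      field_simp
  have := norm_sub_le_norm_sub_add_norm_sub (∑ i, α (ZZNet.permVec (Equiv.swap i 0) Z) * Z i)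
    (∑ i, ZZNet.exactWeight f δ (ZZNet.permVec (Equiv.swap i 0) Z) * Z i) (f Z)
  linarith [happ Z hZ]
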